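/- Let $k$ be a field and let $n\ge 2$ be an integer. Let $T(n)$ be the associative unital $k$-algebra with generators $u_0,u_1,\dots,u_n$ and defining relations $$u_i^2=0 \text{ for all } i,\qquad u_iu_j=u_ju_i \text{ if } |i-j|>1,\qquad u_iu_ju_i=0 \text{ if } |i-j|=1 \text{ and } 1\le i,j\le n-1,$$ $$u_1u_0u_1=0,\qquad u_{n-1}u_nu_{n-1}=0.$$ Let $q$ be an indeterminate, let $M_q(n)$ be the free $k[q]$-module with basis the $2^n$ strings $r_0r_1\cdots r_{n-1}$ of length $n$ on the alphabet $\{+,-\}$, and let $\widetilde M_q(n)=k[q,q^{-1}]\otimes_{k[q]}M_q(n)$. Define $k[q]$-linear operators $U_0,\dots,U_n$ on $M_q(n)$ as follows: - $U_0(r_0r_1\cdots r_{n-1})=q\cdot({-}\,r_1\cdots r_{n-1})$ if $r_0=+$, and $0$ otherwise; - for $1\le i\le n-1$, $U_i(r_0\cdots r_{n-1})=r_0\cdots r_{i-2}\,{+}\,{-}\,r_{i+1}\cdots r_{n-1}$ if $r_{i-1}r_i={-}{+}$, and $0$ otherwise; - $U_n(r_0\cdots r_{n-1})=r_0\cdots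 r_{n-2}\,{+}$ if $r_{n-1}=-$, and $0$ otherwise. **Theorem 2.4.** Letting each $u_i$ act as $U_i$ makes $M_q(n)$ a $T(n)$-module, and this action is faithful: the $k$-algebra homomorphism $T(n)\to\operatorname{End}_{k[q]}(M_q(n))$ with $u_i\mapsto U_i$ is well defined and injective. Likewise, letting each $u_i$ act as the scalar extension $\mathrm{id}\otimes U_i$ gives a faithful action of $T(n)$ on $\widetilde M_q(n)$: the $k$-algebra homomorphism $T(n)\to\operatorname{End}_{k[q,q^{-1}]}(\widetilde M_q(n))$ with $u_i\mapsto \mathrm{id}\otimes U_i$ is well defined and injective. -/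

import Mathlib

open scoped Polynomial LaurentPolynomial TensorProduct

/-- The defining relations of the nil Temperley–Lieb algebra of type affine `C`, on the free
`k`-algebra with generators `u_0, …, u_n`. -/
inductive NTLRel (k : Type*) [Field k] (n : ℕ) :
    FreeAlgebra k (Fin (n + 1)) → FreeAlgebra k (Fin (n + 1)) → Prop
  /-- `u_i² = 0` for all `i`. -/
  | sq (i : Fin (n + 1)) :
      NTLRel k n (FreeAlgebra.ι k i * FreeAlgebra.ι k i) 0
  /-- `u_i u_j = u_j u_i` if `|i - j| > 1`. -/
  | comm (i j : Fin (n + 1)) (h : 1 < |(i.val : ℤ) - (j.val : ℤ)|) :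
      NTLRel k n (FreeAlgebra.ι k i * FreeAlgebra.ι k j) (FreeAlgebra.ι k j * FreeAlgebra.ι k i)
  /-- `u_i u_j u_i = 0` if `|i - j| = 1` and `1 ≤ i, j ≤ n - 1`. -/
  | inner (i j : Fin (n + 1)) (h : |(i.val : ℤ) - (j.val : ℤ)| = 1)
      (hi : 1 ≤ i.val) (hi' : i.val < n) (hj : 1 ≤ j.val) (hj' : j.val < n) :
      NTLRel k n (FreeAlgebra.ι k i * FreeAlgebra.ι k j * FreeAlgebra.ι k i) 0
  /-- `u_1 u_0 u_1 = 0`. -/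
  | left (i j : Fin (n + 1)) (hi : i.val = 1) (hj : j.val = 0) :
      NTLRel k n (FreeAlgebra.ι k i * FreeAlgebra.ι k j * FreeAlgebra.ι k i) 0
  /-- `u_{n-1} u_n u_{n-1} = 0`. -/
  | right (i j : Fin (n + 1)) (hi : i.val + 1 = n) (hj : j.val = n) :
      NTLRel k n (FreeAlgebra.ι k i * FreeAlgebra.ι k j * FreeAlgebra.ι k i) 0

/-- The nil Temperley–Lieb algebra `T(n)` of type affine `C` over `k`. -/
abbrev NTL (k : Type*) [Field k] (n : ℕ) : Type _ := RingQuot (NTLRel k n)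

/-- The generator `u_i` of `T(n)`. -/
noncomputable def NTL.u (k : Type*) [Field k] (n : ℕ) (i : Fin (n + 1)) : NTL k n :=
  RingQuot.mkAlgHom k (NTLRel k n) (FreeAlgebra.ι k i)

/-- Strings `r_0 r_1 ⋯ r_{n-1}` on the alphabet `{+, -}`: `true` is `+` (a particle is present)
and `false` is `-` (no particle). -/
abbrev SignString (n : ℕ) : Type := Fin n → Bool

/-- `M_q(n)`: the free `k[q]`-module on the strings of length `n`; here `q` is `Polynomial.X`. -/
abbrev Mq (k : Type*) [Field k] (n : ℕ) : Type _ := SignString n →₀ k[X]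

/-- `k[q, q⁻¹] ⊗_{k[q]} M_q(n)`. (`k[q, q⁻¹]` is a `k[q]`-module through its structure of a
`k[q]`-algebra; this instance is named because Mathlib has a second, definitionally equal one.) -/
abbrev MqLaurent (k : Type*) [Field k] (n : ℕ) : Type _ :=
  letI : Module k[X] k[T;T⁻¹] := Algebra.toModule
  k[T;T⁻¹] ⊗[k[X]] Mq k n

namespace Mq

variable (k : Type*) [Field k] {n : ℕ}

/-- Annihilation at position `p`: turns `r_p = +` into `-`, and kills strings with `r_p = -`. -/
noncomputable def annihilate (p : Fin n) : Module.End k[X] (Mq k n) :=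
  Finsupp.linearCombination k[X] fun r : SignString n =>
    if r p = true then Finsupp.single (Function.update r p false) (1 : k[X]) else 0

/-- Creation at position `p`: turns `r_p = -` into `+`, and kills strings with `r_p = +`. -/
noncomputable def create (p : Fin n) : Module.End k[X] (Mq k n) :=
  Finsupp.linearCombination k[X] fun r : SignString n =>
    if r p = false then Finsupp.single (Function.update r p true) (1 : k[X]) else 0

/-- Moving a particle from position `a` to position `b`: if `r_a = +` and `r_b = -`, these two
signs are interchanged; all other strings are killed. -/
noncomputable def move (a b : Fin n) : Module.End k[X] (Mq k n) :=
  Finsupp.linearCombination k[X] fun r : SignString n =>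
    if r a = true ∧ r b = false then
      Finsupp.single (Function.update (Function.update r a false) b true) (1 : k[X])
    else 0

/-- The `k[q]`-linear operator by which the generator `u_i` acts on `M_q(n)`: `q` times
annihilation at position `0` if `i = 0`, creation at position `n - 1` if `i = n`, and moving a
particle from position `i` to position `i - 1` if `1 ≤ i ≤ n - 1`. -/
noncomputable def op (hn : 2 ≤ n) (i : Fin (n + 1)) : Module.End k[X] (Mq k n) :=
  if h0 : i.val = 0 then (Polynomial.X : k[X]) • annihilate k ⟨0, by omega⟩
  else if h1 : i.val = n then create k ⟨n - 1, by omega⟩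
  else move k ⟨i.val, by omega⟩ ⟨i.val - 1, by omega⟩

end Mq

/-!
A string is a configuration of particles on the sites `0, …, n - 1`, and each generator moves one
particle to the left: `u_n` lets it enter at the right end, `u_0` lets it leave at the left end, at
the price of a factor `q`. The site `s` is emptied by `u_s`, filled by `u_{s+1}`, and not affected
by the other generators. So a word that does not kill a string uses `u_s` and `u_{s+1}` alternately,
for every `s`, and sends the string to `q ^ d` times a string, with `d` the number of its letters
`u_0`.

The defining relations hold for the operators for this reason, and faithfulness follows from two
facts about words.

* A monomial that does not vanish in `T(n)` does not kill every string
  (`NTL.exists_runs_of_mon_ne_zero`). If `u_i w` kills every string and `w` does not, then the last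
  letter of `w` at one of the sites of `u_i` was `u_i` itself, and the relations give `u_i w = 0`
  (`NTL.Runs.u_mul_mon_eq_zero`).
* Two words that send some string to the same multiple `q ^ d r'` of the same string are equal in
  `T(n)` (`NTL.Runs.mon_eq`). By conservation of particles they have the same content
  (`NTL.Runs.count_eq`), and a letter that acts last in one of them can be commuted to the last
  place in the other (`NTL.Runs.exists_cons`), because the final string shows which of two
  neighbouring letters acted last.

Hence for every nonzero monomial `m` some matrix coefficient (a string, its image, and a power of
`q`) is `1` on `m` and `0` on all other monomials. As the monomials span `T(n)`, the action on
`M_q(n)` is faithful. So is its scalar extension, since `M_q(n)` is free and `k[q]` embeds into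
`k[q, q⁻¹]`.
-/

namespace NTL

/-! ### Words acting on strings -/

/-- The letter `i` acts at the site `s`: the site `s` lies between the generators `u_s`, which
empties it, and `u_{s+1}`, which fills it. -/
def Touches {n : ℕ} (i : Fin (n + 1)) (s : Fin n) : Prop :=
  i.val = s.val ∨ i.val = s.val + 1

/-- The state in which the letter `i` leaves a site `s` that it touches; before `i` acts, the site
has to be in the opposite state. -/
def after {n : ℕ} (i : Fin (n + 1)) (s : Fin n) : Bool :=
  decide (i.val = s.val + 1)

/-- The letter `i` turns the string `r` into the string `r'`, up to a power of `q`. -/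
def Step {n : ℕ} (i : Fin (n + 1)) (r r' : SignString n) : Prop :=
  ∀ s, (Touches i s → r s = !after i s ∧ r' s = after i s) ∧ (¬ Touches i s → r' s = r s)

/-- The word `w` turns the string `r` into the string `r'`, up to a power of `q`. As in a product
of operators, the head of the list acts last. -/
def Runs {n : ℕ} : List (Fin (n + 1)) → SignString n → SignString n → Prop
  | [], r, r' => r = r'
  | i :: w, r, r' => ∃ m, Runs w r m ∧ Step i m r'

section Combinatorics

variable {n : ℕ}

theorem after_inj {i j : Fin (n + 1)} {s : Fin n} (hi : Touches i s) (hj : Touches j s)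
    (h : after i s = after j s) : i = j := by
  unfold Touches at hi hj
  simp only [after, decide_eq_decide] at h
  ext; omega

theorem after_eq_not {i j : Fin (n + 1)} {s : Fin n} (hi : Touches i s) (hj : Touches j s)
    (h : i ≠ j) : after i s = !after j s := by
  by_contra hc
  exact h (after_inj hi hj (by simpa using hc))

theorem not_touches_of_far {i j : Fin (n + 1)} (h : 1 < |(i.val : ℤ) - (j.val : ℤ)|)
    {s : Fin n} (hi : Touches i s) : ¬ Touches j s := by
  unfold Touches at *
  rw [lt_abs] at h
  omega

theorem exists_common_site {i j : Fin (n + 1)} (h : |(i.val : ℤ) - (j.val : ℤ)| = 1) :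
    ∃ s, Touches i s ∧ Touches j s := by
  rw [abs_eq (by norm_num)] at h
  rcases h with h | h
  · have := i.isLt
    exact ⟨⟨j.val, by omega⟩, by simp only [Touches]; omega, Or.inl rfl⟩
  · have := j.isLt
    exact ⟨⟨i.val, by omega⟩, Or.inl rfl, by simp only [Touches]; omega⟩

theorem eq_or_adj_or_far (i j : Fin (n + 1)) :
    i = j ∨ |(i.val : ℤ) - (j.val : ℤ)| = 1 ∨ 1 < |(i.val : ℤ) - (j.val : ℤ)| := by
  by_cases h : i = j
  · exact Or.inl h
  · have h' : (i.val : ℤ) - j.val ≠ 0 := fun hc => h (by ext; omega)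
    have := Int.one_le_abs h'
    omega

theorem Step.unique_left {i : Fin (n + 1)} {a b r : SignString n} (ha : Step i a r)
    (hb : Step i b r) : a = b := by
  funext s
  by_cases hs : Touches i s
  · rw [((ha s).1 hs).1, ((hb s).1 hs).1]
  · rw [← (ha s).2 hs, ← (hb s).2 hs]

open Classical in
theorem exists_step {i : Fin (n + 1)} {r : SignString n}
    (h : ∀ s, Touches i s → r s = !after i s) : ∃ r', Step i r r' :=
  ⟨fun s => if Touches i s then after i s else r s, fun s =>
    ⟨fun hs => ⟨h s hs, if_pos hs⟩, fun hs => if_neg hs⟩⟩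

open Classical in
/-- Letters at distance greater than one act at disjoint sets of sites. -/
theorem Step.swap {i j : Fin (n + 1)} (h : 1 < |(i.val : ℤ) - (j.val : ℤ)|)
    {a b c : SignString n} (hi : Step i a b) (hj : Step j b c) :
    ∃ b', Step j a b' ∧ Step i b' c := by
  refine ⟨fun s => if Touches j s then c s else a s, fun s => ⟨fun hs => ?_, fun hs => if_neg hs⟩,
    fun s => ⟨fun hs => ?_, fun hs => ?_⟩⟩
  · have hi' : ¬ Touches i s := fun hc => not_touches_of_far h hc hs
    exact ⟨by rw [← (hi s).2 hi', ((hj s).1 hs).1], by simp [hs, ((hj s).1 hs).2]⟩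
  · have hj' := not_touches_of_far h hs
    exact ⟨by simp [hj', ((hi s).1 hs).1], by rw [(hj s).2 hj', ((hi s).1 hs).2]⟩
  · by_cases hj' : Touches j s
    · simp [hj']
    · simp [hj', (hj s).2 hj', (hi s).2 hs]

/-- If a word touches the site `s` and leaves it in the state in which `i` leaves it, then the last
letter to touch `s` was `i`. -/
theorem Runs.mem_of_after {w : List (Fin (n + 1))} {r r' : SignString n} (hw : Runs w r r')
    {i j : Fin (n + 1)} {s : Fin n} (hi : Touches i s) (hj : Touches j s) (hjw : j ∈ w)
    (h : r' s = after i s) : i ∈ w := by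
  induction w generalizing r' with
  | nil => simp at hjw
  | cons l w ih =>
    obtain ⟨m, hm, hs⟩ := hw
    by_cases hl : Touches l s
    · have : l = i := after_inj hl hi (by rw [← h, ((hs s).1 hl).2])
      simp [this]
    · have hjl : j ≠ l := fun hc => hl (hc ▸ hj)
      exact List.mem_cons_of_mem _
        (ih hm ((List.mem_cons.1 hjw).resolve_left hjl) (by rw [← (hs s).2 hl, h]))

open Classical in
/-- The signs at sites that a word does not touch may be chosen freely. -/
theorem Runs.override {w : List (Fin (n + 1))} {r r' : SignString n} (hw : Runs w r r')
    (Q : Fin n → Prop) (f : SignString n) (hQ : ∀ s, Q s → ∀ j ∈ w, ¬ Touches j s) :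
    Runs w (fun s => if Q s then f s else r s) (fun s => if Q s then f s else r' s) := by
  induction w generalizing r' with
  | nil => cases hw; rfl
  | cons i w ih =>
    obtain ⟨m, hm, hs⟩ := hw
    refine ⟨_, ih hm fun s h j hj => hQ s h j (List.mem_cons_of_mem _ hj), fun s => ?_⟩
    by_cases hq : Q s
    · simp [hq, hQ s hq i List.mem_cons_self]
    · simpa [hq] using hs s

/-- Conservation of particles at the site `s`. -/
theorem Runs.count_add {w : List (Fin (n + 1))} {r r' : SignString n} (hw : Runs w r r')
    (s : Fin n) :
    w.count s.succ + (r s).toNat = w.count s.castSucc + (r' s).toNat := by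
  induction w generalizing r' with
  | nil => cases hw; simp
  | cons i w ih =>
    obtain ⟨m, hm, hs⟩ := hw
    have h := ih hm
    by_cases h1 : i = s.castSucc
    · subst h1
      have hn : s.castSucc ≠ s.succ := fun hc => by simpa using congrArg Fin.val hc
      have := (hs s).1 (Or.inl rfl)
      simp [after] at this
      simp [this, hn] at h ⊢
      omega
    · by_cases h2 : i = s.succ
      · subst h2
        have := (hs s).1 (Or.inr rfl)
        simp [after] at this
        simp [this, h1] at h ⊢
        omega
      · have : ¬ Touches i s := by
          rintro (hc | hc)
          · exact h1 (Fin.ext hc)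
          · exact h2 (Fin.ext hc)
        simp [(hs s).2 this, h1, h2] at h ⊢
        omega

/-- The content of a word is determined by the strings it connects and by the number of its
letters `0`. -/
theorem Runs.count_eq {w w' : List (Fin (n + 1))} {r r' : SignString n} (hw : Runs w r r')
    (hw' : Runs w' r r') (h0 : w.count 0 = w'.count 0) (i : Fin (n + 1)) :
    w.count i = w'.count i := by
  induction i using Fin.induction with
  | zero => exact h0
  | succ s ih =>
    have := hw.count_add s
    have := hw'.count_add s
    omega

theorem not_runs_sq (i : Fin (n + 1)) (hn : 0 < n) (r r' : SignString n) : ¬ Runs [i, i] r r' := by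
  rintro ⟨m, ⟨m', -, h'⟩, h⟩
  obtain ⟨s, hs⟩ : ∃ s : Fin n, Touches i s := by
    by_cases hi : i.val < n
    · exact ⟨⟨i.val, hi⟩, Or.inl rfl⟩
    · exact ⟨⟨i.val - 1, by omega⟩, by simp only [Touches]; omega⟩
  have h1 := ((h s).1 hs).1
  have h2 := ((h' s).1 hs).2
  simp [h2] at h1

/-- An inner letter `i` touches a site that its neighbour `j` does not touch. -/
theorem not_runs_braid (i j : Fin (n + 1)) (hij : |(i.val : ℤ) - (j.val : ℤ)| = 1)
    (hi : 1 ≤ i.val) (hi' : i.val < n) (r r' : SignString n) : ¬ Runs [i, j, i] r r' := by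
  rintro ⟨m, ⟨m', ⟨m'', -, h''⟩, h'⟩, h⟩
  obtain ⟨s, hs, hjs⟩ : ∃ s : Fin n, Touches i s ∧ ¬ Touches j s := by
    rw [abs_eq (by norm_num)] at hij
    rcases hij with hij | hij
    · exact ⟨⟨i.val, hi'⟩, Or.inl rfl, by simp only [Touches]; omega⟩
    · exact ⟨⟨i.val - 1, by omega⟩, by simp only [Touches]; omega, by simp only [Touches]; omega⟩
  have h1 := ((h s).1 hs).1
  have h2 := ((h'' s).1 hs).2
  rw [(h' s).2 hjs] at h1
  simp [h2] at h1

theorem runs_comm (i j : Fin (n + 1)) (h : 1 < |(i.val : ℤ) - (j.val : ℤ)|) (r r' : SignString n)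
    (hr : Runs [i, j] r r') : Runs [j, i] r r' := by
  obtain ⟨m, ⟨m', rfl, h'⟩, hs⟩ := hr
  obtain ⟨b, hb, hb'⟩ := h'.swap (by rwa [abs_sub_comm]) hs
  exact ⟨b, ⟨_, rfl, hb⟩, hb'⟩

end Combinatorics

/-! ### Monomials in the algebra -/

/-- The monomial of `T(n)` spelled by a word. -/
noncomputable def mon (k : Type*) [Field k] {n : ℕ} (w : List (Fin (n + 1))) : NTL k n :=
  (w.map (NTL.u k n)).prod

section Monomials

variable (k : Type*) [Field k] {n : ℕ}

theorem mon_cons (i : Fin (n + 1)) (w : List (Fin (n + 1))) :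
    mon k (i :: w) = NTL.u k n i * mon k w := by
  simp [mon]

theorem u_mul_self (i : Fin (n + 1)) : NTL.u k n i * NTL.u k n i = 0 := by
  simpa [NTL.u] using RingQuot.mkAlgHom_rel k (NTLRel.sq (k := k) i)

theorem u_comm {i j : Fin (n + 1)} (h : 1 < |(i.val : ℤ) - (j.val : ℤ)|) :
    NTL.u k n i * NTL.u k n j = NTL.u k n j * NTL.u k n i := by
  simpa [NTL.u] using RingQuot.mkAlgHom_rel k (NTLRel.comm (k := k) i j h)

theorem u_braid {i j : Fin (n + 1)} (h : |(i.val : ℤ) - (j.val : ℤ)| = 1) (hi : 1 ≤ i.val)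
    (hi' : i.val < n) : NTL.u k n i * NTL.u k n j * NTL.u k n i = 0 := by
  have key : NTLRel k n (FreeAlgebra.ι k i * FreeAlgebra.ι k j * FreeAlgebra.ι k i) 0 := by
    by_cases h0 : j.val = 0
    · exact .left i j (by rw [abs_eq (by norm_num)] at h; omega) h0
    · by_cases h1 : j.val = n
      · exact .right i j (by rw [abs_eq (by norm_num)] at h; omega) h1
      · exact .inner i j h hi hi' (by omega) (by omega)
  simpa [NTL.u] using RingQuot.mkAlgHom_rel k key

/-- If a word contains the letter `i` and ends in a string that `i` could have produced, then the
word can be rewritten, by commutation relations only, so that `i` acts last: no neighbour of `i` can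
act after the last `i`. -/
theorem Runs.exists_cons {w : List (Fin (n + 1))} {r r' : SignString n} (hw : Runs w r r')
    {i : Fin (n + 1)} (hi : i ∈ w) (h : ∀ s, Touches i s → r' s = after i s) :
    ∃ v, Runs (i :: v) r r' ∧ w.Perm (i :: v) ∧ mon k w = mon k (i :: v) := by
  induction w generalizing r' with
  | nil => simp at hi
  | cons j w ih =>
    rcases eq_or_adj_or_far i j with rfl | hij | hij
    · exact ⟨w, hw, List.Perm.refl _, rfl⟩
    · obtain ⟨s, his, hjs⟩ := exists_common_site hij
      obtain ⟨m, hm, hs⟩ := hw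
      have : i = j := after_inj his hjs (by rw [← h s his, ((hs s).1 hjs).2])
      simp [this] at hij
    · obtain ⟨m, hm, hs⟩ := hw
      have hne : i ≠ j := by rintro rfl; simp at hij
      obtain ⟨v, ⟨m', hv, hs'⟩, hp, he⟩ := ih hm ((List.mem_cons.1 hi).resolve_left hne)
        fun s hi => by rw [← (hs s).2 (not_touches_of_far hij hi), h s hi]
      obtain ⟨b, hb, hb'⟩ := hs'.swap hij hs
      refine ⟨j :: v, ⟨b, ⟨m', hv, hb⟩, hb'⟩, (hp.cons j).trans (List.Perm.swap i j v), ?_⟩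
      rw [mon_cons, he, mon_cons, mon_cons, mon_cons, ← mul_assoc, ← mul_assoc, u_comm k hij]

/-- Two words that connect the same two strings with the same power of `q` represent the same
monomial. -/
theorem Runs.mon_eq {w w' : List (Fin (n + 1))} {r r' : SignString n} (hw : Runs w r r')
    (hw' : Runs w' r r') (h0 : w.count 0 = w'.count 0) : mon k w = mon k w' := by
  have hp : w.Perm w' := List.perm_iff_count.2 (hw.count_eq hw' h0)
  clear h0
  induction w generalizing w' r' with
  | nil => rw [List.nil_perm.1 hp]
  | cons i w ih =>
    obtain ⟨m, hm, hs⟩ := hw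
    obtain ⟨v, ⟨m', hv, hs'⟩, hp', he⟩ := hw'.exists_cons k
      (hp.mem_iff.1 List.mem_cons_self) fun s hi => ((hs s).1 hi).2
    obtain rfl := hs.unique_left hs'
    rw [he, mon_cons, mon_cons, ih hm hv (hp.trans hp').cons_inv]

/-- If the last letter to touch some site of `i` was `i` itself, then no further `i` may act: either
two letters `i` can be brought together, or a single neighbour, on the other side of `i`, is left
between them. -/
theorem Runs.u_mul_mon_eq_zero {w : List (Fin (n + 1))} {r r' : SignString n} (hw : Runs w r r')
    {i : Fin (n + 1)} (hi : i ∈ w) {s : Fin n} (his : Touches i s) (h : r' s = after i s) :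
    NTL.u k n i * mon k w = 0 := by
  induction w generalizing r' with
  | nil => simp at hi
  | cons j w ih =>
    obtain ⟨m, hm, hs⟩ := hw
    rw [mon_cons, ← mul_assoc]
    rcases eq_or_adj_or_far i j with rfl | hij | hij
    · rw [u_mul_self, zero_mul]
    · have hne : i ≠ j := by rintro rfl; simp at hij
      have hjs : ¬ Touches j s := fun hjs =>
        hne (after_inj his hjs (by rw [← h, ((hs s).1 hjs).2]))
      obtain ⟨t, hit, hjt⟩ := exists_common_site hij
      have hst : s ≠ t := fun hc => hjs (hc ▸ hjt)
      -- `s` and `t` are the two sites of `i`, and both are in the state in which `i` leaves them.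
      obtain ⟨v, -, -, he⟩ := hm.exists_cons k ((List.mem_cons.1 hi).resolve_left hne)
        fun x hx => by
          by_cases hxj : Touches j x
          · rw [((hs x).1 hxj).1, after_eq_not hx hxj hne]
          · have : x = s := by
              unfold Touches at *
              rw [abs_eq (by norm_num)] at hij
              ext; omega
            rw [this, ← (hs s).2 hjs, h]
      have hst' : s.val ≠ t.val := fun hc => hst (Fin.ext hc)
      have h1 : 1 ≤ i.val ∧ i.val < n := by
        unfold Touches at *
        omega
      rw [he, mon_cons, ← mul_assoc, u_braid k hij h1.1 h1.2, zero_mul]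
    · have hne : i ≠ j := by rintro rfl; simp at hij
      rw [u_comm k hij, mul_assoc, ih hm ((List.mem_cons.1 hi).resolve_left hne)
        (by rw [← (hs s).2 (not_touches_of_far hij his), h]), mul_zero]

open Classical in
/-- A monomial that does not vanish in `T(n)` acts on some string without killing it. -/
theorem exists_runs_of_mon_ne_zero (w : List (Fin (n + 1))) (hw : mon k w ≠ 0) :
    ∃ r r', Runs w r r' := by
  induction w with
  | nil => exact ⟨fun _ => true, _, rfl⟩
  | cons i w ih =>
    rw [mon_cons] at hw
    obtain ⟨r, r', h⟩ := ih (right_ne_zero_of_mul hw)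
    have hgood : ∀ s, Touches i s → ∀ j ∈ w, Touches j s → r' s = !after i s := by
      intro s his j hjw hjs
      by_contra hc
      have hc : r' s = after i s := by simpa using hc
      exact hw (h.u_mul_mon_eq_zero k (h.mem_of_after his hjs hjw hc) his hc)
    -- The sites that `w` does not touch are put into the state that `i` needs.
    let Q : Fin n → Prop := fun s => ∀ j ∈ w, ¬ Touches j s
    have h' := h.override Q (fun s => !after i s) fun _ hs => hs
    refine ⟨_, (exists_step (i := i) fun s his => ?_).imp fun _ hr'' => ⟨_, h', hr''⟩⟩
    by_cases hq : Q s
    · simp [hq]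
    · obtain ⟨j, hjw, hjs⟩ : ∃ j ∈ w, Touches j s := by
        by_contra hc
        exact hq fun j hj hjs => hc ⟨j, hj, hjs⟩
      simp [hq, hgood s his j hjw hjs]

theorem span_range_mon : Submodule.span k (Set.range (mon k (n := n))) = ⊤ := by
  rw [eq_top_iff]
  rintro x -
  obtain ⟨y, rfl⟩ := RingQuot.mkAlgHom_surjective k (NTLRel k n) x
  induction y using FreeAlgebra.induction with
  | grade0 c =>
    rw [AlgHom.commutes, Algebra.algebraMap_eq_smul_one]
    exact Submodule.smul_mem _ _ (Submodule.subset_span ⟨[], rfl⟩)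
  | grade1 i => exact Submodule.subset_span ⟨[i], by simp [mon, NTL.u]⟩
  | add a b ha hb => rw [map_add]; exact add_mem ha hb
  | mul a b ha hb =>
    rw [map_mul]
    have := Submodule.mul_mem_mul ha hb
    rw [Submodule.span_mul_span] at this
    refine Submodule.span_mono ?_ this
    rintro _ ⟨_, ⟨v, rfl⟩, _, ⟨w, rfl⟩, rfl⟩
    exact ⟨v ++ w, by simp [mon]⟩

end Monomials

/-! ### The action on `M_q(n)` and its faithfulness -/

section Action

open Polynomial

variable (k : Type*) [Field k] {n : ℕ}

theorem op_single_of_step (hn : 2 ≤ n) {i : Fin (n + 1)} {r r' : SignString n} (h : Step i r r') :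
    Mq.op k hn i (Finsupp.single r 1) = Finsupp.single r' (X ^ [i].count 0) := by
  have h1 : ∀ s : Fin n, i.val = s.val → r s = true ∧ r' s = false := fun s hs => by
    have := (h s).1 (Or.inl hs); simpa [after, hs] using this
  have h2 : ∀ s : Fin n, i.val = s.val + 1 → r s = false ∧ r' s = true := fun s hs => by
    have := (h s).1 (Or.inr hs); simpa [after, hs] using this
  have h3 : ∀ s : Fin n, i.val ≠ s.val → i.val ≠ s.val + 1 → r' s = r s := fun s a b =>
    (h s).2 (by rintro (hc | hc); exacts [a hc, b hc])
  unfold Mq.op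
  split_ifs with h0 hN
  · have hi : i = 0 := Fin.ext h0
    have hr' : Function.update r ⟨0, by omega⟩ false = r' := by
      funext s
      by_cases hs : s = ⟨0, by omega⟩
      · subst hs; simp [(h1 ⟨0, by omega⟩ h0).2]
      · have : s.val ≠ 0 := fun hc => hs (Fin.ext hc)
        simp [Function.update_of_ne hs, h3 s (by omega) (by omega)]
    simp [Mq.annihilate, (h1 ⟨0, by omega⟩ h0).1, hr', hi]
  · have hi : i ≠ 0 := fun hc => h0 (by simp [hc])
    have hr' : Function.update r ⟨n - 1, by omega⟩ true = r' := by
      funext s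
      by_cases hs : s = ⟨n - 1, by omega⟩
      · subst hs; simp [(h2 ⟨n - 1, by omega⟩ (by simp; omega)).2]
      · have : s.val ≠ n - 1 := fun hc => hs (Fin.ext hc)
        simp [Function.update_of_ne hs, h3 s (by omega) (by omega)]
    simp [Mq.create, (h2 ⟨n - 1, by omega⟩ (by simp; omega)).1, hr', hi]
  · have hi : i ≠ 0 := fun hc => h0 (by simp [hc])
    have hr' : Function.update (Function.update r ⟨i.val, by omega⟩ false)
        ⟨i.val - 1, by omega⟩ true = r' := by
      funext s
      by_cases hs : s = ⟨i.val - 1, by omega⟩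
      · subst hs; simp [(h2 ⟨i.val - 1, by omega⟩ (by simp; omega)).2]
      · have hs1 : s.val ≠ i.val - 1 := fun hc => hs (Fin.ext hc)
        rw [Function.update_of_ne hs]
        by_cases hs' : s = ⟨i.val, by omega⟩
        · rw [hs']; simp [(h1 ⟨i.val, by omega⟩ rfl).2]
        · have : s.val ≠ i.val := fun hc => hs' (Fin.ext hc)
          rw [Function.update_of_ne hs', h3 s (by omega) (by omega)]
    simp [Mq.move, (h2 ⟨i.val - 1, by omega⟩ (by simp; omega)).1, (h1 ⟨i.val, by omega⟩ rfl).1,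
      hr', hi]

theorem op_single_of_not_step (hn : 2 ≤ n) {i : Fin (n + 1)} {r : SignString n}
    (h : ∀ r', ¬ Step i r r') : Mq.op k hn i (Finsupp.single r 1) = 0 := by
  obtain ⟨s, his, hrs⟩ : ∃ s, Touches i s ∧ r s ≠ !after i s := by
    by_contra hc
    push Not at hc
    obtain ⟨r', hr'⟩ := exists_step hc
    exact h r' hr'
  have hrs : r s = after i s := by simpa using hrs
  unfold Mq.op
  split_ifs with h0 hN
  · obtain rfl : s = ⟨0, by omega⟩ := by ext; unfold Touches at his; simp; omega
    simp [after, h0] at hrs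
    simp [Mq.annihilate, hrs]
  · have hs : s = ⟨n - 1, by omega⟩ := by ext; unfold Touches at his; simp; omega
    have : r ⟨n - 1, by omega⟩ = true := by rw [← hs, hrs]; simp [after, hs]; omega
    simp [Mq.create, this]
  · rcases his with his | his
    · have hs : s = ⟨i.val, by omega⟩ := Fin.ext his.symm
      have : r ⟨i.val, by omega⟩ = false := by rw [← hs, hrs]; simp [after, hs]
      simp [Mq.move, this]
    · have hs : s = ⟨i.val - 1, by omega⟩ := by ext; simp; omega
      have : r ⟨i.val - 1, by omega⟩ = true := by rw [← hs, hrs]; simp [after, his]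
      simp [Mq.move, this]

/-- The operator on `M_q(n)` spelled by a word. -/
noncomputable def opWord (hn : 2 ≤ n) (w : List (Fin (n + 1))) : Module.End k[X] (Mq k n) :=
  (w.map (Mq.op k hn)).prod

theorem opWord_cons (hn : 2 ≤ n) (i : Fin (n + 1)) (w : List (Fin (n + 1))) :
    opWord k hn (i :: w) = Mq.op k hn i * opWord k hn w := by
  simp [opWord]

theorem opWord_single_of_runs (hn : 2 ≤ n) {w : List (Fin (n + 1))} {r r' : SignString n}
    (h : Runs w r r') :
    opWord k hn w (Finsupp.single r 1) = Finsupp.single r' (X ^ w.count 0) := by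
  induction w generalizing r' with
  | nil => cases h; simp [opWord]
  | cons i w ih =>
    obtain ⟨m, hm, hs⟩ := h
    have e : (Finsupp.single m (X ^ w.count 0) : Mq k n)
        = (X ^ w.count 0 : k[X]) • Finsupp.single m 1 := by simp
    rw [opWord_cons, Module.End.mul_apply, ih hm, e, map_smul, op_single_of_step k hn hs,
      Finsupp.smul_single, smul_eq_mul, ← pow_add, ← List.count_append,
      (List.perm_append_comm (l₁ := w) (l₂ := [i])).count_eq, List.singleton_append]

theorem opWord_single_of_not_runs (hn : 2 ≤ n) {w : List (Fin (n + 1))} {r : SignString n}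
    (h : ∀ r', ¬ Runs w r r') : opWord k hn w (Finsupp.single r 1) = 0 := by
  induction w with
  | nil => exact absurd rfl (h r)
  | cons i w ih =>
    rw [opWord_cons, Module.End.mul_apply]
    by_cases hw : ∃ m, Runs w r m
    · obtain ⟨m, hm⟩ := hw
      have e : (Finsupp.single m (X ^ w.count 0) : Mq k n)
          = (X ^ w.count 0 : k[X]) • Finsupp.single m 1 := by simp
      rw [opWord_single_of_runs k hn hm, e, map_smul,
        op_single_of_not_step k hn fun r' hr' => h r' ⟨m, hm, hr'⟩, smul_zero]
    · rw [ih (not_exists.1 hw), map_zero]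

theorem opWord_congr (hn : 2 ≤ n) {w w' : List (Fin (n + 1))}
    (h : ∀ r r', Runs w r r' ↔ Runs w' r r') (h0 : w.count 0 = w'.count 0) :
    opWord k hn w = opWord k hn w' := by
  refine Finsupp.lhom_ext' fun r => LinearMap.ext_ring ?_
  simp only [LinearMap.comp_apply, Finsupp.lsingle_apply]
  by_cases hr : ∃ r', Runs w r r'
  · obtain ⟨r', hr'⟩ := hr
    rw [opWord_single_of_runs k hn hr', opWord_single_of_runs k hn ((h r r').1 hr'), h0]
  · rw [opWord_single_of_not_runs k hn (not_exists.1 hr),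
      opWord_single_of_not_runs k hn fun r' hr' => hr ⟨r', (h r r').2 hr'⟩]

theorem opWord_eq_zero (hn : 2 ≤ n) {w : List (Fin (n + 1))} (h : ∀ r r', ¬ Runs w r r') :
    opWord k hn w = 0 := by
  refine Finsupp.lhom_ext' fun r => LinearMap.ext_ring ?_
  simp [opWord_single_of_not_runs k hn (h r)]

theorem lift_op_eq_of_rel (hn : 2 ≤ n) ⦃a b : FreeAlgebra k (Fin (n + 1))⦄ (h : NTLRel k n a b) :
    FreeAlgebra.lift k (Mq.op k hn) a = FreeAlgebra.lift k (Mq.op k hn) b := by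
  have braid : ∀ i j : Fin (n + 1), |(i.val : ℤ) - (j.val : ℤ)| = 1 → 1 ≤ i.val → i.val < n →
      Mq.op k hn i * Mq.op k hn j * Mq.op k hn i = 0 := fun i j h hi hi' => by
    simpa [opWord, mul_assoc] using opWord_eq_zero k hn (not_runs_braid i j h hi hi')
  cases h with
  | sq i => simpa [opWord] using opWord_eq_zero k hn (not_runs_sq i (by omega))
  | comm i j h =>
    simpa [opWord] using opWord_congr k hn (fun r r' => ⟨runs_comm i j h r r',
      runs_comm j i (by rwa [abs_sub_comm]) r r'⟩) ((List.Perm.swap j i []).count_eq 0)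
  | inner i j h hi hi' hj hj' => simpa using braid i j h hi hi'
  | left i j hi hj => simpa using braid i j (by simp [hi, hj]) (by omega) (by omega)
  | right i j hi hj =>
    simpa using braid i j (by rw [abs_eq (by norm_num)]; omega) (by omega) (by omega)

/-- The action of `T(n)` on `M_q(n)`. -/
noncomputable def toEnd (hn : 2 ≤ n) : NTL k n →ₐ[k] Module.End k[X] (Mq k n) :=
  RingQuot.liftAlgHom k ⟨FreeAlgebra.lift k (Mq.op k hn), lift_op_eq_of_rel k hn⟩

theorem toEnd_u (hn : 2 ≤ n) (i : Fin (n + 1)) : toEnd k hn (NTL.u k n i) = Mq.op k hn i := by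
  simp [toEnd, NTL.u]

theorem toEnd_mon (hn : 2 ≤ n) (w : List (Fin (n + 1))) :
    toEnd k hn (mon k w) = opWord k hn w := by
  simp [mon, opWord, map_list_prod, Function.comp_def, toEnd_u]

/-- The coefficient of `q ^ d • r'` in the image of the string `r`, as a linear form on operators. -/
noncomputable def matrixCoeff (r r' : SignString n) (d : ℕ) :
    Module.End k[X] (Mq k n) →ₗ[k] k where
  toFun f := (f (Finsupp.single r 1) r').coeff d
  map_add' := by simp
  map_smul' := by simp

theorem matrixCoeff_opWord_self (hn : 2 ≤ n) {w : List (Fin (n + 1))} {r r' : SignString n}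
    (h : Runs w r r') : matrixCoeff k r r' (w.count 0) (opWord k hn w) = 1 := by
  simp [matrixCoeff, opWord_single_of_runs k hn h]

theorem matrixCoeff_opWord_of_ne (hn : 2 ≤ n) {w v : List (Fin (n + 1))} {r r' : SignString n}
    (h : Runs w r r') (hv : mon k v ≠ mon k w) :
    matrixCoeff k r r' (w.count 0) (opWord k hn v) = 0 := by
  by_cases hr : ∃ m, Runs v r m
  · obtain ⟨m, hm⟩ := hr
    simp only [matrixCoeff, LinearMap.coe_mk, AddHom.coe_mk, opWord_single_of_runs k hn hm]
    by_cases hmr : m = r'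
    · subst hmr
      have : w.count 0 ≠ v.count 0 := fun hc => hv (hm.mon_eq k h hc.symm)
      simp [coeff_X_pow, this]
    · simp [hmr]
  · simp [matrixCoeff, opWord_single_of_not_runs k hn (not_exists.1 hr)]

theorem toEnd_injective (hn : 2 ≤ n) : Function.Injective (toEnd k hn) := by
  rw [injective_iff_map_eq_zero]
  intro x hx
  have hmem : x ∈ Submodule.span k (Set.range (mon k (n := n))) := by
    rw [span_range_mon]; trivial
  -- The sum runs over monomials as elements of `T(n)`, so that equivalent words are identified.
  rw [← Subtype.range_coe (s := Set.range (mon k (n := n))),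
    Finsupp.mem_span_range_iff_exists_finsupp] at hmem
  obtain ⟨c, rfl⟩ := hmem
  refine Finset.sum_eq_zero fun b _ => ?_
  obtain ⟨_, w, rfl⟩ := b
  by_cases hw : mon k w = 0
  · simp [hw]
  obtain ⟨r, r', h⟩ := exists_runs_of_mon_ne_zero k w hw
  have hc := congrArg (matrixCoeff k r r' (w.count 0)) hx
  rw [Finsupp.sum, map_sum, map_sum, map_zero, Finset.sum_eq_single ⟨_, w, rfl⟩] at hc
  · rw [map_smul, toEnd_mon, map_smul, matrixCoeff_opWord_self k hn h, smul_eq_mul, mul_one] at hc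
    simp [hc]
  · rintro ⟨_, v, rfl⟩ - hv
    rw [map_smul, toEnd_mon, map_smul, matrixCoeff_opWord_of_ne k hn h fun hc => hv (by simp [hc]),
      smul_zero]
  · intro hc
    simp [Finsupp.notMem_support_iff.1 hc]

end Action

end NTL

/-! ### Scalar extension to `k[q, q⁻¹]` -/

/-- Over an extension `A` of `R`, a free module embeds into its scalar extension, so that an
endomorphism is determined by its base change. -/
theorem eq_of_baseChange_eq {R A M : Type*} [CommRing R] [CommRing A] [Algebra R A]
    [AddCommGroup M] [Module R M] [Module.Free R M]
    (hA : Function.Injective (algebraMap R A)) {f g : Module.End R M}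
    (h : f.baseChange A = g.baseChange A) : f = g := by
  have hinj : Function.Injective fun m : M => (1 : A) ⊗ₜ[R] m := by
    have := (Module.Flat.rTensor_preserves_injective_linearMap (M := M)
      (Algebra.linearMap R A) hA).comp (TensorProduct.lid R M).symm.injective
    convert this using 1
    funext m
    simp
  ext m
  apply hinj
  simpa using LinearMap.congr_fun h (1 ⊗ₜ m)

theorem theorem2p4 (k : Type*) [Field k] (n : ℕ) (hn : 2 ≤ n) :
    (∃ φ : NTL k n →ₐ[k] Module.End k[X] (Mq k n),
      (∀ i : Fin (n + 1), φ (NTL.u k n i) = Mq.op k hn i) ∧ Function.Injective φ) ∧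
    (∃ ψ : NTL k n →ₐ[k] Module.End k[T;T⁻¹] (MqLaurent k n),
      (∀ i : Fin (n + 1), ψ (NTL.u k n i) = (Mq.op k hn i).baseChange k[T;T⁻¹]) ∧
        Function.Injective ψ) := by
  refine ⟨⟨NTL.toEnd k hn, NTL.toEnd_u k hn, NTL.toEnd_injective k hn⟩, ?_⟩
  have : IsScalarTower k k[X] k[T;T⁻¹] := IsScalarTower.of_algebraMap_smul fun c x => by
    rw [Algebra.smul_def, LaurentPolynomial.smul_eq_C_mul, LaurentPolynomial.algebraMap_eq_toLaurent,
      Polynomial.algebraMap_apply, Algebra.algebraMap_self_apply, Polynomial.toLaurent_C]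
  let β : Module.End k[X] (Mq k n) →ₐ[k] Module.End k[T;T⁻¹] (MqLaurent k n) :=
    AlgHom.ofLinearMap
      { toFun := fun f => f.baseChange k[T;T⁻¹]
        map_add' := fun f g => LinearMap.baseChange_add f g
        map_smul' := fun c f => by
          ext m
          simp only [LinearMap.comp_apply, TensorProduct.AlgebraTensorModule.curry_apply,
            TensorProduct.curry_apply, LinearMap.baseChange_tmul,
            LinearMap.smul_apply, RingHom.id_apply, LinearMap.coe_restrictScalars]
          rw [← algebraMap_smul k[X] c, TensorProduct.tmul_smul, TensorProduct.smul_tmul',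
            TensorProduct.smul_tmul', algebraMap_smul] }
      (LinearMap.baseChange_id) (fun f g => LinearMap.baseChange_mul f g)
  refine ⟨β.comp (NTL.toEnd k hn), fun i => ?_, ?_⟩
  · change (NTL.toEnd k hn (NTL.u k n i)).baseChange k[T;T⁻¹] = _
    rw [NTL.toEnd_u]
  · refine Function.Injective.comp (g := β) (fun f g h => ?_) (NTL.toEnd_injective k hn)
    exact eq_of_baseChange_eq (A := k[T;T⁻¹]) Polynomial.toLaurent_injective h
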